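/- Let $K=\{x_1,\dots,x_N\}$ be a finite set and let $V=\{V(x)\}_{x\in K}$ be a spectral process on $K$, i.e. a non-negative random function with $\mathbb{E}\,V(x)=1$ for every $x\in K$. Let $\Gamma_1<\Gamma_2<\dots$ be the arrival times of a unit rate Poisson process on $(0,\infty)$ (independent standard exponential interarrival times), with independent markings $V_1,V_2,\dots$ that are independent copies of $V$ and independent of $(\Gamma_j)$. Put $\varphi_j=\Gamma_j^{-1}V_j$ and $\Phi=\{\varphi_j: j\in\mathbb{N}\}$, and let $Z$ be the simple max-stable process with spectral process $V$, i.e. $\{Z(x)\}_{x\in K}$ has the distribution of $\{\max_{j}\varphi_j(x)\}_{x\in K}$. For each $k\in\{1,\dots,N\}$ the extremal function $\varphi_+^{(k)}$ is the (almost surely unique) $\varphi\in\Phi$ with $\varphi(x_k)=\max_{j}\varphi_j(x_k)$; the $\ell$-th step of the extremal functions algorithm determines $\varphi_+^{(\ell)}$. Let $\Phi_+=\{\varphi_+^{(1)},\dots,\varphi_+^{(N)}\}$ be the set of all extremal functions and, for $n\le N$, let $$M_+^{(n)}=\bigl|\Phi_+\setminus\{\varphi_+^{(1)},\dots,\varphi_+^{(n)}\}\bigr|$$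 be the number of missing extremal functions after $n$ steps of the algorithm. Then, for every $n\le N$, all the following expectations are finite and $$\mathbb{E}\bigl(M_+^{(n)}\bigr)=\mathbb{E}\Bigl\{\sup_{x\in K}\frac{V(x)}{Z(x)}\Bigr\}-\mathbb{E}\Bigl\{\max_{i=1,\dots,n}\frac{V(x_i)}{Z(x_i)}\Bigr\},$$ where on the right-hand side $Z$ and $V$ are taken to be stochastically independent (and a maximum over an empty index set is $0$). -/

import Mathlib

open MeasureTheory ProbabilityTheory

namespace MaxStable

/-- Interarrival times `Γ₀, Γ₁ - Γ₀, Γ₂ - Γ₁, …` of a sequence of random times. -/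
noncomputable def interarrival {Ω : Type*} (Γ : ℕ → Ω → ℝ) : ℕ → Ω → ℝ
  | 0 => Γ 0
  | j + 1 => fun ω => Γ (j + 1) ω - Γ j ω

/-- `Γ` are the arrival times of a unit rate Poisson process on `(0, ∞)`: the interarrival
times are independent and standard exponential. -/
structure IsUnitPoissonArrival {Ω : Type*} [MeasurableSpace Ω] (Γ : ℕ → Ω → ℝ)
    (P : Measure Ω) : Prop where
  indep : iIndepFun (interarrival Γ) P
  law : ∀ j, HasLaw (interarrival Γ j) (expMeasure 1) P

/-- `V` is a spectral process on the finite domain `K = {x₁, …, x_N}`, whose points are indexed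
by `Fin N`: a nonnegative random function on `K` whose value at every point has mean `1`. -/
structure IsSpectralProcess {Ω : Type*} [MeasurableSpace Ω] {N : ℕ} (V : Ω → Fin N → ℝ)
    (P : Measure Ω) : Prop where
  aemeasurable : AEMeasurable V P
  nonneg : ∀ᵐ ω ∂P, ∀ k, 0 ≤ V ω k
  mean_one : ∀ k, ∫ ω, V ω k ∂P = 1

/-- `Γ` are unit rate Poisson arrival times with independent markings `W j`, which are
independent copies of the process `V`. -/
structure IsMarkedPoisson {Ω Ω' : Type*} [MeasurableSpace Ω] [MeasurableSpace Ω'] {N : ℕ}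
    (V : Ω → Fin N → ℝ) (P : Measure Ω)
    (Γ : ℕ → Ω' → ℝ) (W : ℕ → Ω' → Fin N → ℝ) (P' : Measure Ω') : Prop where
  arrival : IsUnitPoissonArrival Γ P'
  mark_indep : iIndepFun W P'
  mark_law : ∀ j, IdentDistrib (W j) V P' P
  indep : IndepFun (fun ω j => Γ j ω) (fun ω j => W j ω) P'

/-- The functions `φ_j = Γ_j⁻¹ V_j` on `K`. -/
noncomputable def phi {Ω : Type*} {N : ℕ} (Γ : ℕ → Ω → ℝ) (W : ℕ → Ω → Fin N → ℝ)
    (ω : Ω) (j : ℕ) : Fin N → ℝ :=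
  fun k => (Γ j ω)⁻¹ * W j ω k

/-- The pointwise maximum `max_j Γ_j⁻¹ V_j` of the functions `φ_j`. -/
noncomputable def maxProcess {Ω : Type*} {N : ℕ} (Γ : ℕ → Ω → ℝ) (W : ℕ → Ω → Fin N → ℝ)
    (ω : Ω) : Fin N → ℝ :=
  fun k => ⨆ j, phi Γ W ω j k

/-- `f` is the extremal function `φ₊^{(k)}` of the collection `Φ` at the point `x_k`: it belongs
to `Φ` and attains the maximum over `Φ` at `x_k`. -/
def IsExtremalAt {N : ℕ} (Φ : Set (Fin N → ℝ)) (k : Fin N) (f : Fin N → ℝ) : Prop :=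
  f ∈ Φ ∧ ∀ g ∈ Φ, g k ≤ f k

/-- The extremal functions `φ₊^{(1)}, …, φ₊^{(n)}` found in the first `n` steps of the extremal
functions algorithm (step `ℓ` determines the extremal function at the `ℓ`-th point). -/
def extremalUpTo {N : ℕ} (Φ : Set (Fin N → ℝ)) (n : ℕ) : Set (Fin N → ℝ) :=
  {f | ∃ k : Fin N, (k : ℕ) < n ∧ IsExtremalAt Φ k f}

/-- The set `Φ₊ = {φ₊^{(1)}, …, φ₊^{(N)}}` of all extremal functions. -/
def extremalFunctions {N : ℕ} (Φ : Set (Fin N → ℝ)) : Set (Fin N → ℝ) :=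
  {f | ∃ k : Fin N, IsExtremalAt Φ k f}

/-- The number `M₊^{(n)}` of extremal functions still missing after `n` steps. -/
noncomputable def missing {Ω : Type*} {N : ℕ} (Γ : ℕ → Ω → ℝ) (W : ℕ → Ω → Fin N → ℝ)
    (n : ℕ) (ω : Ω) : ℕ∞ :=
  (extremalFunctions (Set.range (phi Γ W ω)) \ extremalUpTo (Set.range (phi Γ W ω)) n).encard

end MaxStable

open scoped ENNReal

namespace MaxStable

open Filter Topology

/-! ### Inserting a coordinate into an i.i.d. sequence -/

/-- The strictly increasing enumeration of `ℕ \ {j}`. -/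
def skip (j i : ℕ) : ℕ := if i < j then i else i + 1

/-- The sequence obtained from `y` by inserting `a` at position `j`. -/
def insertAt {E : Type*} (j : ℕ) (a : E) (y : ℕ → E) (i : ℕ) : E :=
  if i < j then y i else if i = j then a else y (i - 1)

lemma skip_injective (j : ℕ) : Function.Injective (skip j) := by
  intro a b h; unfold skip at h; split_ifs at h <;> omega

lemma exists_skip_eq {j i : ℕ} (h : i ≠ j) : ∃ l, skip j l = i := by
  rcases lt_or_gt_of_ne h with h | h
  · exact ⟨i, by simp [skip, h]⟩
  · exact ⟨i - 1, by unfold skip; split_ifs <;> omega⟩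

section insertAt
variable {E : Type*}

@[simp] lemma insertAt_self (j : ℕ) (a : E) (y : ℕ → E) : insertAt j a y j = a := by
  simp [insertAt]

@[simp] lemma insertAt_skip (j : ℕ) (a : E) (y : ℕ → E) (i : ℕ) :
    insertAt j a y (skip j i) = y i := by
  unfold insertAt skip; split_ifs <;> first | rfl | omega

lemma sum_insertAt_of_le {j m : ℕ} (h : m ≤ j) (a : ℝ) (y : ℕ → ℝ) :
    ∑ i ∈ Finset.range m, insertAt j a y i = ∑ i ∈ Finset.range m, y i := by
  refine Finset.sum_congr rfl fun i hi => ?_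
  simp [insertAt, (Finset.mem_range.1 hi).trans_le h]

lemma sum_insertAt_succ {j m : ℕ} (h : j ≤ m) (a : ℝ) (y : ℕ → ℝ) :
    ∑ i ∈ Finset.range (m + 1), insertAt j a y i = a + ∑ i ∈ Finset.range m, y i := by
  induction m, h using Nat.le_induction with
  | base => rw [Finset.sum_range_succ, sum_insertAt_of_le le_rfl, insertAt_self, add_comm]
  | succ m hm ih =>
    rw [Finset.sum_range_succ, ih, Finset.sum_range_succ, add_assoc]
    congr 2
    unfold insertAt; split_ifs <;> first | rfl | omega

variable [MeasurableSpace E]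

lemma measurable_insertAt (j : ℕ) :
    Measurable (fun p : E × (ℕ → E) => insertAt j p.1 p.2) := by
  refine measurable_pi_lambda _ fun i => ?_
  unfold insertAt
  split_ifs <;> fun_prop

/-- Inserting an independent coordinate into an i.i.d. sequence yields an i.i.d. sequence. -/
lemma measurePreserving_insertAt (j : ℕ) (m : Measure E) [IsProbabilityMeasure m] :
    MeasurePreserving (fun p : E × (ℕ → E) => insertAt j p.1 p.2)
      (m.prod (Measure.infinitePi fun _ : ℕ => m)) (Measure.infinitePi fun _ : ℕ => m) := by
  classical
  refine ⟨measurable_insertAt j, Measure.eq_infinitePi _ fun s t ht => ?_⟩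
  rw [Measure.map_apply (measurable_insertAt j)
    (.pi s.countable_toSet fun i _ => ht i)]
  -- A cylinder condition splits into one on the inserted value and one on the remaining
  -- coordinates.
  have hpre : (fun p : E × (ℕ → E) => insertAt j p.1 p.2) ⁻¹' (Set.pi s t) =
      (if j ∈ s then t j else Set.univ) ×ˢ
        Set.pi ↑((s.erase j).preimage (skip j) (skip_injective j).injOn) (fun i => t (skip j i)) := by
    ext ⟨a, y⟩
    simp only [Set.mem_preimage, Set.mem_pi, SetLike.mem_coe, Set.mem_prod, Finset.mem_preimage,
      Finset.mem_erase]
    constructor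
    · intro h
      refine ⟨?_, fun i hi => by simpa using h _ hi.2⟩
      split_ifs with hj
      · simpa using h j hj
      · trivial
    · rintro ⟨h1, h2⟩ i hi
      by_cases hij : i = j
      · subst hij; simpa [hi] using h1
      · obtain ⟨l, rfl⟩ := exists_skip_eq hij
        simpa using h2 l ⟨hij, hi⟩
  rw [hpre, Measure.prod_prod, Measure.infinitePi_pi _ (fun i _ => ht _),
    Finset.prod_preimage (skip j) (s.erase j) _ (fun i => m (t i))]
  · split_ifs with hj
    · rw [Finset.mul_prod_erase s (fun i => m (t i)) hj]
    · simp [Finset.erase_eq_of_notMem hj]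
  · intro i hi hir
    exact absurd (exists_skip_eq (Finset.ne_of_mem_erase hi)) hir

lemma lintegral_infinitePi_insertAt (j : ℕ) (m : Measure E) [IsProbabilityMeasure m]
    {f : (ℕ → E) → ℝ≥0∞} (hf : Measurable f) :
    ∫⁻ x, f x ∂(Measure.infinitePi fun _ : ℕ => m) =
      ∫⁻ y, ∫⁻ a, f (insertAt j a y) ∂m ∂(Measure.infinitePi fun _ : ℕ => m) := by
  rw [← (measurePreserving_insertAt j m).lintegral_comp hf,
    lintegral_prod_symm' (fun p : E × (ℕ → E) => f (insertAt j p.1 p.2))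
      (hf.comp (measurable_insertAt j))]

end insertAt

/-! ### Exponential gaps and deletion of one arrival -/

instance : IsProbabilityMeasure (expMeasure 1) := isProbabilityMeasure_expMeasure one_pos

lemma expMeasure_eq_withDensity : expMeasure 1 = volume.withDensity (exponentialPDF 1) := rfl

@[fun_prop]
lemma measurable_exponentialPDF : Measurable (exponentialPDF 1) :=
  (measurable_exponentialPDFReal 1).ennreal_ofReal

/-- The exponents add up to `-c`, and the supports force `0 ≤ a ≤ c`. The point `a = 0` is excluded
because the density equals `1` there while `Ioc 0 c` omits it. -/
lemma exponentialPDF_mul_sub {a c : ℝ} (ha : a ≠ 0) :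
    exponentialPDF 1 a * exponentialPDF 1 (c - a) =
      exponentialPDF 1 c * (Set.Ioc 0 c).indicator 1 a := by
  by_cases h : a ∈ Set.Ioc 0 c
  · have h0 := h.1.le
    have h1 : 0 ≤ c - a := sub_nonneg.2 h.2
    rw [Set.indicator_of_mem h, exponentialPDF_of_nonneg h0, exponentialPDF_of_nonneg h1,
      exponentialPDF_of_nonneg (h0.trans h.2), ← ENNReal.ofReal_mul (by positivity)]
    simp only [one_mul, ← Real.exp_add, Pi.one_apply, mul_one]
    congr 2; ring
  · rw [Set.indicator_of_notMem h, mul_zero]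
    rcases lt_or_gt_of_ne ha with h0 | h0
    · rw [exponentialPDF_of_neg h0, zero_mul]
    · rw [exponentialPDF_of_neg (x := c - a), mul_zero]
      by_contra! h2
      exact h ⟨h0, by linarith⟩

/-- If `a`, `b` are independent standard exponential then the law of `(a, a + b)` is Lebesgue
measure on `(0, c]` mixed over standard exponential `c`. -/
lemma lintegral_expMeasure_add {f : ℝ → ℝ → ℝ≥0∞} (hf : Measurable (Function.uncurry f)) :
    ∫⁻ a, ∫⁻ b, f a (a + b) ∂expMeasure 1 ∂expMeasure 1 =
      ∫⁻ c, (∫⁻ u in Set.Ioc 0 c, f u c) ∂expMeasure 1 := by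
  have hf' : Measurable fun p : ℝ × ℝ => f p.1 p.2 := hf
  have hind : Measurable fun p : ℝ × ℝ => (Set.Ioc 0 p.2).indicator (1 : ℝ → ℝ≥0∞) p.1 := by
    have : MeasurableSet {p : ℝ × ℝ | p.1 ∈ Set.Ioc 0 p.2} :=
      (measurableSet_lt measurable_const measurable_fst).inter
        (measurableSet_le measurable_fst measurable_snd)
    exact measurable_const.indicator (f := fun _ : ℝ × ℝ => (1 : ℝ≥0∞)) this
  calc ∫⁻ a, ∫⁻ b, f a (a + b) ∂expMeasure 1 ∂expMeasure 1
      = ∫⁻ a, exponentialPDF 1 a * ∫⁻ b, exponentialPDF 1 b * f a (a + b) := by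
        rw [expMeasure_eq_withDensity, lintegral_withDensity_eq_lintegral_mul _ measurable_exponentialPDF]
        · refine lintegral_congr fun a => ?_
          rw [Pi.mul_apply, lintegral_withDensity_eq_lintegral_mul _ (by fun_prop) (by fun_prop)]
          rfl
        · exact Measurable.lintegral_prod_right'
            (f := fun p : ℝ × ℝ => f p.1 (p.1 + p.2)) (by fun_prop)
    _ = ∫⁻ a, ∫⁻ c, exponentialPDF 1 a * (exponentialPDF 1 (c - a) * f a c) := by
        refine lintegral_congr fun a => ?_
        rw [lintegral_const_mul _ (by fun_prop),
          ← lintegral_sub_right_eq_self (fun b => exponentialPDF 1 b * f a (a + b)) a]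
        simp
    _ = ∫⁻ a, ∫⁻ c, exponentialPDF 1 c * ((Set.Ioc 0 c).indicator 1 a * f a c) := by
        have h0 : ∀ᵐ a : ℝ, a ≠ 0 := by
          simp [ae_iff]
        refine lintegral_congr_ae (h0.mono fun a ha => ?_)
        refine lintegral_congr fun c => ?_
        rw [← mul_assoc, exponentialPDF_mul_sub ha, mul_assoc]
    _ = ∫⁻ c, ∫⁻ a, exponentialPDF 1 c * ((Set.Ioc 0 c).indicator 1 a * f a c) := by
        apply lintegral_lintegral_swap
        exact (((measurable_exponentialPDF.comp measurable_snd).mul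
          (hind.mul hf')).aemeasurable)
    _ = ∫⁻ c, exponentialPDF 1 c * ∫⁻ u in Set.Ioc 0 c, f u c := by
        refine lintegral_congr fun c => ?_
        rw [lintegral_const_mul, ← lintegral_indicator measurableSet_Ioc]
        · congr 2 with a
          by_cases h : a ∈ Set.Ioc 0 c <;> simp [h]
        · exact (hind.comp (measurable_id.prodMk measurable_const)).mul (by fun_prop)
    _ = _ := by
        rw [expMeasure_eq_withDensity, lintegral_withDensity_eq_lintegral_mul _ (by fun_prop)]
        · rfl
        · have : Measurable fun c => ∫⁻ a, (Set.Ioc 0 c).indicator 1 a * f a c :=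
            Measurable.lintegral_prod_left' (f := fun p : ℝ × ℝ =>
              (Set.Ioc 0 p.2).indicator 1 p.1 * f p.1 p.2) (hind.mul hf')
          convert this using 2 with c
          rw [← lintegral_indicator measurableSet_Ioc]
          congr 1 with a
          by_cases h : a ∈ Set.Ioc 0 c <;> simp [h]

/-- The sequence of partial sums `x₀, x₀ + x₁, …`. -/
def arrivals (x : ℕ → ℝ) (j : ℕ) : ℝ := ∑ i ∈ Finset.range (j + 1), x i

@[fun_prop]
lemma measurable_arrivals : Measurable arrivals := by
  unfold arrivals; fun_prop

lemma arrivals_insertAt_self (j : ℕ) (a : ℝ) (y : ℕ → ℝ) :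
    arrivals (insertAt j a y) j = a + ∑ i ∈ Finset.range j, y i :=
  sum_insertAt_succ le_rfl a y

/-- Deleting the `j`-th arrival merges the gaps `a` and `b` on either side of it, so the other
arrivals see only `a + b`. -/
lemma arrivals_insertAt_insertAt_skip (j : ℕ) (a b : ℝ) (y : ℕ → ℝ) (i : ℕ) :
    arrivals (insertAt j a (insertAt j b y)) (skip j i) = arrivals (insertAt j (a + b) y) i := by
  unfold arrivals
  by_cases h : i < j
  · have h' : i + 1 ≤ j := h
    simp only [skip, h, if_true]
    rw [sum_insertAt_of_le h', sum_insertAt_of_le h', sum_insertAt_of_le h']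
  · have h' : j ≤ i := not_lt.1 h
    simp only [skip, h, if_false]
    rw [sum_insertAt_succ (by omega), sum_insertAt_succ h', sum_insertAt_succ h', add_assoc]

/-- The law of an i.i.d. sequence of standard exponential random variables. -/
noncomputable abbrev expSeq : Measure (ℕ → ℝ) := Measure.infinitePi fun _ : ℕ => expMeasure 1

/-- Removing the `j`-th arrival time. -/
lemma lintegral_expSeq_remove (j : ℕ) {f : ℝ → (ℕ → ℝ) → ℝ≥0∞}
    (hf : Measurable (Function.uncurry f)) :
    ∫⁻ x, f (arrivals x j) (fun i => arrivals x (skip j i)) ∂expSeq =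
      ∫⁻ x, (∫⁻ u in Set.Ioc (∑ i ∈ Finset.range j, x i) (∑ i ∈ Finset.range (j + 1), x i),
        f u (arrivals x)) ∂expSeq := by
  have hf' : Measurable fun p : ℝ × (ℕ → ℝ) => f p.1 p.2 := hf
  have hm (j : ℕ) : Measurable (fun p : ℝ × (ℕ → ℝ) => insertAt j p.1 p.2) :=
    measurable_insertAt j
  have harr (n : ℕ) : Measurable fun x => arrivals x n :=
    (measurable_pi_apply n).comp measurable_arrivals
  have hL : Measurable fun x : ℕ → ℝ => f (arrivals x j) (fun i => arrivals x (skip j i)) :=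
    hf'.comp ((harr j).prodMk (measurable_pi_lambda _ fun i => harr _))
  have hR : Measurable fun x : ℕ → ℝ =>
      ∫⁻ u in Set.Ioc (∑ i ∈ Finset.range j, x i) (∑ i ∈ Finset.range (j + 1), x i),
        f u (arrivals x) := by
    have hs : MeasurableSet {p : (ℕ → ℝ) × ℝ | p.2 ∈ Set.Ioc (∑ i ∈ Finset.range j, p.1 i)
        (∑ i ∈ Finset.range (j + 1), p.1 i)} :=
      (measurableSet_lt (by fun_prop) measurable_snd).inter
        (measurableSet_le measurable_snd (by fun_prop))
    have := Measurable.lintegral_prod_right' (ν := volume) ((hf'.comp (measurable_snd.prodMk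
      (measurable_arrivals.comp measurable_fst)) :
        Measurable fun p : (ℕ → ℝ) × ℝ => f p.2 (arrivals p.1)).indicator hs)
    convert this using 2 with x
    rw [← lintegral_indicator measurableSet_Ioc]
    rfl
  -- One gap is singled out on the right, but two on the left (here and in the next rewrite), since
  -- there both gaps adjacent to the deleted arrival matter.
  rw [lintegral_infinitePi_insertAt j _ hL, lintegral_infinitePi_insertAt j _ hR]
  have hL' : Measurable fun z : ℕ → ℝ => ∫⁻ a, f (arrivals (insertAt j a z) j)
      (fun i => arrivals (insertAt j a z) (skip j i)) ∂expMeasure 1 :=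
    Measurable.lintegral_prod_left' (hL.comp (hm j))
  rw [lintegral_infinitePi_insertAt j _ hL']
  refine lintegral_congr fun y => ?_
  simp only [arrivals_insertAt_self, arrivals_insertAt_insertAt_skip]
  set s := ∑ i ∈ Finset.range j, y i with hs
  have h1 (c : ℝ) : ∑ i ∈ Finset.range j, insertAt j c y i = s := sum_insertAt_of_le le_rfl _ _
  have h2 (c : ℝ) : ∑ i ∈ Finset.range (j + 1), insertAt j c y i = c + s :=
    sum_insertAt_succ le_rfl _ _
  simp only [h1, h2]
  have hg : Measurable (Function.uncurry fun u c : ℝ => f (u + s) (arrivals (insertAt j c y))) := by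
    refine hf'.comp ((measurable_fst.add_const s).prodMk (measurable_arrivals.comp ?_))
    exact (hm j).comp (measurable_snd.prodMk measurable_const)
  have hsw := lintegral_expMeasure_add hg
  -- The inserted coordinates appear with `a` innermost, the opposite order to
  -- `lintegral_expMeasure_add`.
  rw [lintegral_lintegral_swap] at hsw
  · refine hsw.trans (lintegral_congr fun c => ?_)
    rw [← lintegral_indicator measurableSet_Ioc, ← lintegral_indicator measurableSet_Ioc,
      ← lintegral_add_right_eq_self ((Set.Ioc s (c + s)).indicator _) s]
    congr 1 with u
    simp [Set.indicator]
  · exact (hg.comp (measurable_fst.prodMk (measurable_fst.add measurable_snd))).aemeasurable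

lemma ae_expMeasure_pos : ∀ᵐ x ∂expMeasure 1, 0 < x := by
  have h0 : ∀ᵐ x ∂(volume : Measure ℝ), x ≠ 0 := by simp [ae_iff]
  rw [expMeasure_eq_withDensity, ae_withDensity_iff (by fun_prop)]
  filter_upwards [h0] with x hx hx'
  by_contra! h
  exact hx' (exponentialPDF_of_neg (lt_of_le_of_ne h hx))

/-! ### Law of large numbers, growth of arrivals and decay of the functions -/

section Averages
variable {E : Type*} [MeasurableSpace E]

lemma ae_tendsto_average (m : Measure E) [IsProbabilityMeasure m] {f : E → ℝ}
    (hf : Measurable f) (hi : Integrable f m) :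
    ∀ᵐ x ∂(Measure.infinitePi fun _ : ℕ => m),
      Tendsto (fun n : ℕ => (∑ i ∈ Finset.range n, f (x i)) / n) atTop (𝓝 (∫ a, f a ∂m)) := by
  have hmp (i : ℕ) := measurePreserving_eval_infinitePi (fun _ : ℕ => m) i
  have hid (i : ℕ) : IdentDistrib (fun x : ℕ → E => f (x i)) (fun x : ℕ → E => f (x 0))
      (Measure.infinitePi fun _ : ℕ => m) (Measure.infinitePi fun _ : ℕ => m) := by
    refine IdentDistrib.comp (u := f) ⟨(hmp i).measurable.aemeasurable,
      (hmp 0).measurable.aemeasurable, ?_⟩ hf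
    exact (hmp i).map_eq.trans (hmp 0).map_eq.symm
  have hind : iIndepFun (fun i (x : ℕ → E) => f (x i)) (Measure.infinitePi fun _ : ℕ => m) :=
    iIndepFun_infinitePi (X := fun _ => f) fun _ => hf
  have key := strong_law_ae_real (fun i (x : ℕ → E) => f (x i))
    ((hmp 0).integrable_comp_of_integrable hi)
    (fun i j hij => hind.indepFun hij) hid
  rwa [show (∫ x : ℕ → E, f (x 0) ∂(Measure.infinitePi fun _ : ℕ => m)) = ∫ a, f a ∂m from
    (integral_map (hmp 0).measurable.aemeasurable hf.aestronglyMeasurable).symm.trans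
      (by rw [(hmp 0).map_eq])] at key

end Averages

lemma ae_expSeq_pos : ∀ᵐ x ∂expSeq, ∀ i, 0 < x i :=
  ae_all_iff.2 fun i =>
    (measurePreserving_eval_infinitePi (fun _ : ℕ => expMeasure 1) i).quasiMeasurePreserving.ae
      ae_expMeasure_pos

/-- The arrival times grow at least linearly. -/
lemma ae_expSeq_linear_growth :
    ∀ᵐ x ∂expSeq, ∃ c : ℝ, 0 < c ∧ ∀ᶠ n : ℕ in atTop, c * n ≤ ∑ i ∈ Finset.range n, x i := by
  -- Truncation at `1` makes integrability immediate; only a positive mean is needed for a linear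
  -- lower bound.
  have hm : Measurable fun x : ℝ => min x 1 := by fun_prop
  have hpos : ∀ᵐ x ∂expMeasure 1, 0 < min x 1 := ae_expMeasure_pos.mono fun x hx => by simpa using hx
  have hi : Integrable (fun x : ℝ => min x 1) (expMeasure 1) := by
    refine Integrable.of_bound hm.aestronglyMeasurable 1 (hpos.mono fun x hx => ?_)
    rw [Real.norm_of_nonneg hx.le]
    exact min_le_right _ _
  have hc : 0 < ∫ x, min x 1 ∂expMeasure 1 := by
    rw [integral_pos_iff_support_of_nonneg_ae (hpos.mono fun x hx => hx.le) hi]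
    have : Function.support (fun x : ℝ => min x 1) =ᵐ[expMeasure 1] Set.univ :=
      eventuallyEq_univ.2 (hpos.mono fun x hx => hx.ne')
    rw [measure_congr this]
    simp
  filter_upwards [ae_tendsto_average (expMeasure 1) hm hi] with x hx
  refine ⟨_, half_pos hc, ?_⟩
  filter_upwards [hx.eventually (lt_mem_nhds (half_lt_self hc)), eventually_gt_atTop 0] with n hn h0
  have h0' : (0 : ℝ) < n := by exact_mod_cast h0
  rw [lt_div_iff₀ h0'] at hn
  exact hn.le.trans (Finset.sum_le_sum fun i _ => min_le_left _ _)

lemma ae_expSeq_tendsto :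
    ∀ᵐ x ∂expSeq, Tendsto (fun n : ℕ => ∑ i ∈ Finset.range n, x i) atTop atTop := by
  filter_upwards [ae_expSeq_linear_growth] with x ⟨c, hc, h⟩
  exact tendsto_atTop_mono' _ h (tendsto_natCast_atTop_atTop.const_mul_atTop hc)

/-- The functions `g_j⁻¹ w_j`. -/
noncomputable def scaled {N : ℕ} (g : ℕ → ℝ) (w : ℕ → Fin N → ℝ) (j : ℕ) (k : Fin N) : ℝ :=
  (g j)⁻¹ * w j k

/-- With `S n` the partial sums, `y n / (n + 1)` is `S (n + 1) / (n + 1) - (S n / n) * (n / (n +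
1))`, a difference of two sequences with limit `l`. -/
lemma tendsto_div_of_tendsto_average {y : ℕ → ℝ} {l : ℝ}
    (h : Tendsto (fun n : ℕ => (∑ i ∈ Finset.range n, y i) / n) atTop (𝓝 l)) :
    Tendsto (fun n : ℕ => y n / (n + 1)) atTop (𝓝 0) := by
  have h1 := (tendsto_add_atTop_iff_nat 1).2 h
  have h2 := h.mul (tendsto_natCast_div_add_atTop (1 : ℝ))
  have := h1.sub h2
  simp only [mul_one, sub_self] at this
  refine this.congr' ?_
  filter_upwards [eventually_gt_atTop 0] with n hn
  have h0 : (n : ℝ) ≠ 0 := by exact_mod_cast hn.ne'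
  rw [Finset.sum_range_succ]
  push_cast
  field_simp
  ring

lemma tendsto_scaled {N : ℕ} {x : ℕ → ℝ} {w : ℕ → Fin N → ℝ} {k : Fin N} {c : ℝ} (hc : 0 < c)
    (hx : ∀ᶠ n : ℕ in atTop, c * n ≤ ∑ i ∈ Finset.range n, x i)
    (hw : ∀ i, 0 ≤ w i k)
    (h : Tendsto (fun n : ℕ => w n k / (n + 1)) atTop (𝓝 0)) :
    Tendsto (fun n => scaled (arrivals x) w n k) atTop (𝓝 0) := by
  have hx' := (tendsto_add_atTop_nat 1).eventually hx
  have h' := h.const_mul c⁻¹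
  rw [mul_zero] at h'
  have hb (n : ℕ) : 0 < c * ((n : ℝ) + 1) := by positivity
  refine tendsto_of_tendsto_of_tendsto_of_le_of_le' tendsto_const_nhds h' ?_ ?_
  · filter_upwards [hx'] with n hn
    have : 0 < arrivals x n := (hb n).trans_le (by simpa [arrivals] using hn)
    exact mul_nonneg (inv_nonneg.2 this.le) (hw n)
  · filter_upwards [hx'] with n hn
    have h2 : c * ((n : ℝ) + 1) ≤ arrivals x n := by simpa [arrivals] using hn
    have := inv_anti₀ (hb n) h2
    calc scaled (arrivals x) w n k ≤ (c * ((n : ℝ) + 1))⁻¹ * w n k :=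
          mul_le_mul_of_nonneg_right this (hw n)
      _ = c⁻¹ * (w n k / (n + 1)) := by rw [mul_inv]; ring

/-! ### The Mecke formula -/

lemma lintegral_Ioi_eq_tsum {x : ℕ → ℝ} (hpos : ∀ i, 0 < x i)
    (hx : Tendsto (fun n : ℕ => ∑ i ∈ Finset.range n, x i) atTop atTop) (f : ℝ → ℝ≥0∞) :
    ∑' j, ∫⁻ u in Set.Ioc (∑ i ∈ Finset.range j, x i) (∑ i ∈ Finset.range (j + 1), x i), f u =
      ∫⁻ u in Set.Ioi 0, f u := by
  have hmono : Monotone fun n : ℕ => ∑ i ∈ Finset.range n, x i :=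
    monotone_nat_of_le_succ fun n => by
      rw [Finset.sum_range_succ]; linarith [hpos n]
  have hU := iUnion_Ioc_map_succ_eq_Ioi (f := fun n : ℕ => ∑ i ∈ Finset.range n, x i)
    (fun i => hmono bot_le) (not_bddAbove_of_tendsto_atTop hx)
  simp only [Nat.bot_eq_zero, Finset.range_zero, Finset.sum_empty] at hU
  rw [← hU, lintegral_iUnion (fun _ => measurableSet_Ioc) hmono.pairwise_disjoint_on_Ioc_succ]
  rfl

/-- The Mecke formula for a marked unit rate Poisson process. -/
lemma tsum_lintegral_remove {E : Type*} [MeasurableSpace E] (ν : Measure E)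
    [IsProbabilityMeasure ν] {F : ℝ → E → (ℕ → ℝ) → (ℕ → E) → ℝ≥0∞}
    (hF : Measurable fun p : ℝ × E × (ℕ → ℝ) × (ℕ → E) => F p.1 p.2.1 p.2.2.1 p.2.2.2) :
    ∑' j, ∫⁻ x, ∫⁻ w, F (arrivals x j) (w j) (fun i => arrivals x (skip j i))
        (fun i => w (skip j i)) ∂(Measure.infinitePi fun _ : ℕ => ν) ∂expSeq =
      ∫⁻ x, (∫⁻ u in Set.Ioi 0, ∫⁻ w, ∫⁻ v, F u v (arrivals x) w ∂ν
        ∂(Measure.infinitePi fun _ : ℕ => ν)) ∂expSeq := by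
  set ρ := Measure.infinitePi fun _ : ℕ => ν with hρ
  have hG : Measurable (Function.uncurry fun (u : ℝ) (g : ℕ → ℝ) =>
      ∫⁻ w, ∫⁻ v, F u v g w ∂ν ∂ρ) := by
    have h1 : Measurable fun q : ((ℝ × (ℕ → ℝ)) × (ℕ → E)) × E => F q.1.1.1 q.2 q.1.1.2 q.1.2 :=
      hF.comp (by fun_prop : Measurable fun q : ((ℝ × (ℕ → ℝ)) × (ℕ → E)) × E =>
        (q.1.1.1, q.2, q.1.1.2, q.1.2))
    exact h1.lintegral_prod_right'.lintegral_prod_right'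
  have hstep (j : ℕ) : ∫⁻ x, ∫⁻ w, F (arrivals x j) (w j) (fun i => arrivals x (skip j i))
        (fun i => w (skip j i)) ∂ρ ∂expSeq =
      ∫⁻ x, (∫⁻ u in Set.Ioc (∑ i ∈ Finset.range j, x i) (∑ i ∈ Finset.range (j + 1), x i),
        ∫⁻ w, ∫⁻ v, F u v (arrivals x) w ∂ν ∂ρ) ∂expSeq := by
    rw [← lintegral_expSeq_remove j hG]
    refine lintegral_congr fun x => ?_
    rw [hρ, lintegral_infinitePi_insertAt j ν]
    · simp
    · exact hF.comp (by fun_prop : Measurable fun w : ℕ → E => (arrivals x j, w j,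
        (fun i => arrivals x (skip j i)), fun i => w (skip j i)))
  simp_rw [hstep]
  rw [← lintegral_tsum]
  · refine lintegral_congr_ae ?_
    filter_upwards [ae_expSeq_pos, ae_expSeq_tendsto] with x hx hx'
    exact lintegral_Ioi_eq_tsum hx hx' _
  · intro j
    have hs : MeasurableSet {p : (ℕ → ℝ) × ℝ | p.2 ∈ Set.Ioc (∑ i ∈ Finset.range j, p.1 i)
        (∑ i ∈ Finset.range (j + 1), p.1 i)} :=
      (measurableSet_lt (by fun_prop) measurable_snd).inter
        (measurableSet_le measurable_snd (by fun_prop))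
    have := Measurable.lintegral_prod_right' (ν := volume) ((hG.comp (measurable_snd.prodMk
      (measurable_arrivals.comp measurable_fst))).indicator hs)
    refine Measurable.aemeasurable ?_
    convert this using 2 with x
    rw [← lintegral_indicator measurableSet_Ioc]
    rfl

/-! ### Records of regular sequences and extremal functions -/

/-- The indices of the functions `φ j` which attain the maximum at one of the points `e i`. -/
def recordSet {N : ℕ} {ι : Type*} (e : ι → Fin N) (φ : ℕ → Fin N → ℝ) : Set ℕ :=
  {j | ∃ i, ∀ l, φ l (e i) ≤ φ j (e i)}

/-- A sequence of functions which are nonnegative, tend to zero, are not all zero at any point, and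
take distinct nonzero values at any point. -/
structure IsRegular {N : ℕ} (φ : ℕ → Fin N → ℝ) : Prop where
  nonneg : ∀ j k, 0 ≤ φ j k
  tendsto : ∀ k, Tendsto (fun j => φ j k) atTop (𝓝 0)
  exists_pos : ∀ k, ∃ j, 0 < φ j k
  eq_of_eq : ∀ i j k, φ i k = φ j k → 0 < φ j k → i = j

namespace IsRegular
variable {N : ℕ} {φ : ℕ → Fin N → ℝ}

lemma bddAbove (h : IsRegular φ) (k : Fin N) : BddAbove (Set.range fun j => φ j k) :=
  (h.tendsto k).bddAbove_range

lemma iSup_pos (h : IsRegular φ) (k : Fin N) : 0 < ⨆ j, φ j k := by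
  obtain ⟨j, hj⟩ := h.exists_pos k
  exact hj.trans_le (le_ciSup (h.bddAbove k) j)

/-- Ties at the value `0` are allowed in `IsRegular`, so uniqueness of a maximiser rests on the
maximum being positive. -/
lemma pos_of_max (h : IsRegular φ) {k : Fin N} {j : ℕ} (hj : ∀ l, φ l k ≤ φ j k) : 0 < φ j k := by
  obtain ⟨l, hl⟩ := h.exists_pos k
  exact hl.trans_le (hj l)

lemma eq_of_max (h : IsRegular φ) {k : Fin N} {i j : ℕ} (hi : ∀ l, φ l k ≤ φ i k)
    (hj : ∀ l, φ l k ≤ φ j k) : i = j :=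
  h.eq_of_eq i j k (le_antisymm (hj i) (hi j)) (h.pos_of_max hj)

lemma injOn_recordSet (h : IsRegular φ) : Set.InjOn φ (recordSet id φ) := by
  rintro i ⟨k, hk⟩ j _ hij
  refine (h.eq_of_eq j i k ?_ (h.pos_of_max hk)).symm
  rw [hij]

lemma encard_recordSet_le (h : IsRegular φ) {ι : Type*} [Fintype ι] (e : ι → Fin N) :
    (recordSet e φ).encard ≤ Fintype.card ι := by
  have hs (i : ι) : {j | ∀ l, φ l (e i) ≤ φ j (e i)}.encard ≤ 1 :=
    Set.encard_le_one_iff.2 fun a b ha hb => h.eq_of_max ha hb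
  -- Each point has at most one maximiser, so `sInf` selects it; its value when there is none is
  -- harmless for an inclusion.
  have hcover : recordSet e φ ⊆
      (fun i : ι => sInf {j | ∀ l, φ l (e i) ≤ φ j (e i)}) '' Set.univ := by
    rintro j ⟨i, hi⟩
    refine ⟨i, trivial, ?_⟩
    exact h.eq_of_max (Nat.sInf_mem (s := {j | ∀ l, φ l (e i) ≤ φ j (e i)}) ⟨j, hi⟩) hi
  refine (Set.encard_le_encard hcover).trans ((Set.encard_image_le _ _).trans ?_)
  simp

end IsRegular

section Extremal
variable {N : ℕ} (φ : ℕ → Fin N → ℝ)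

lemma isExtremalAt_range {k : Fin N} {f : Fin N → ℝ} :
    IsExtremalAt (Set.range φ) k f ↔ ∃ j, (∀ l, φ l k ≤ φ j k) ∧ φ j = f := by
  constructor
  · rintro ⟨⟨j, rfl⟩, h⟩
    exact ⟨j, fun l => h _ ⟨l, rfl⟩, rfl⟩
  · rintro ⟨j, h, rfl⟩
    exact ⟨⟨j, rfl⟩, by rintro _ ⟨l, rfl⟩; exact h l⟩

lemma extremalFunctions_range :
    extremalFunctions (Set.range φ) = φ '' recordSet id φ := by
  ext f
  simp only [extremalFunctions, isExtremalAt_range, Set.mem_ofPred_eq, Set.mem_image, recordSet, id]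
  constructor
  · rintro ⟨k, j, h, rfl⟩; exact ⟨j, ⟨k, h⟩, rfl⟩
  · rintro ⟨j, ⟨k, h⟩, rfl⟩; exact ⟨k, j, h, rfl⟩

lemma extremalUpTo_range {n : ℕ} (hn : n ≤ N) :
    extremalUpTo (Set.range φ) n = φ '' recordSet (Fin.castLE hn) φ := by
  ext f
  simp only [extremalUpTo, isExtremalAt_range, Set.mem_ofPred_eq, Set.mem_image, recordSet]
  constructor
  · rintro ⟨k, hk, j, h, rfl⟩; exact ⟨j, ⟨⟨k, hk⟩, h⟩, rfl⟩
  · rintro ⟨j, ⟨k, h⟩, rfl⟩; exact ⟨Fin.castLE hn k, k.2, j, h, rfl⟩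

lemma recordSet_subset {ι : Type*} (e : ι → Fin N) : recordSet e φ ⊆ recordSet id φ :=
  fun _ ⟨i, h⟩ => ⟨e i, h⟩

variable {φ}

/-- Distinct record indices give distinct functions, so the difference of images is the image of the
difference, with the same cardinality. -/
lemma encard_missing (h : IsRegular φ) {n : ℕ} (hn : n ≤ N) :
    (extremalFunctions (Set.range φ) \ extremalUpTo (Set.range φ) n).encard =
      (recordSet id φ \ recordSet (Fin.castLE hn) φ).encard := by
  rw [extremalFunctions_range, extremalUpTo_range φ hn,
    ← h.injOn_recordSet.image_sdiff_subset (recordSet_subset φ _),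
    (h.injOn_recordSet.mono Set.sdiff_subset).encard_image]

end Extremal

/-- The set of levels `u` for which a function `v / u` exceeds the maximum of a regular sequence
at one of finitely many points has length `max v / max φ`. -/
lemma IsRegular.lintegral_record {N : ℕ} {φ : ℕ → Fin N → ℝ} (h : IsRegular φ) {ι : Type*}
    [Finite ι] (e : ι → Fin N) (v : Fin N → ℝ) :
    ∫⁻ u in Set.Ioi (0 : ℝ), {u : ℝ | ∃ i, ∀ l, φ l (e i) ≤ u⁻¹ * v (e i)}.indicator 1 u =
      ENNReal.ofReal (⨆ i, v (e i) / ⨆ j, φ j (e i)) := by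
  set Y := ⨆ i, v (e i) / ⨆ j, φ j (e i) with hY
  have key (u : ℝ) (hu : 0 < u) : (∃ i, ∀ l, φ l (e i) ≤ u⁻¹ * v (e i)) ↔ u ≤ Y := by
    have h1 (i : ι) : (∀ l, φ l (e i) ≤ u⁻¹ * v (e i)) ↔ u ≤ v (e i) / ⨆ j, φ j (e i) := by
      rw [← ciSup_le_iff (h.bddAbove (e i)), le_div_iff₀ (h.iSup_pos _), le_inv_mul_iff₀ hu]
    simp only [h1]
    rcases isEmpty_or_nonempty ι with hι | hι
    -- Over an empty index type the real supremum is `0`, so no `u > 0` qualifies.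
    · simp [hY, hu]
    · constructor
      · rintro ⟨i, hi⟩
        exact hi.trans (le_ciSup (f := fun i => v (e i) / ⨆ j, φ j (e i))
          (Set.finite_range _).bddAbove i)
      · intro hu'
        obtain ⟨i, hi⟩ := exists_eq_ciSup_of_finite (f := fun i => v (e i) / ⨆ j, φ j (e i))
        exact ⟨i, hu'.trans hi.ge⟩
  calc _ = ∫⁻ u in Set.Ioi (0 : ℝ), (Set.Iic Y).indicator 1 u := by
        refine setLIntegral_congr_fun measurableSet_Ioi fun u hu => ?_
        have := key u hu
        by_cases hc : u ≤ Y
        · simp [Set.indicator, this, hc]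
        · simp [Set.indicator, this, hc]
    _ = ENNReal.ofReal Y := by
        rw [lintegral_indicator_one measurableSet_Iic, Measure.restrict_apply measurableSet_Iic,
          Set.inter_comm, Set.Ioi_inter_Iic, Real.volume_Ioc, sub_zero]

lemma encard_eq_tsum (s : Set ℕ) : (s.encard : ℝ≥0∞) = ∑' j, s.indicator 1 j := by
  rw [← ENNReal.tsum_set_one, tsum_subtype s (fun _ => (1 : ℝ≥0∞))]
  rfl

/-! ### Almost sure regularity and the expected number of records -/

/-- The joint law of the interarrival times and of i.i.d. marks with law `ν`. -/
noncomputable abbrev markedLaw {E : Type*} [MeasurableSpace E] (ν : Measure E)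
    [IsProbabilityMeasure ν] : Measure ((ℕ → ℝ) × (ℕ → E)) :=
  expSeq.prod (Measure.infinitePi fun _ : ℕ => ν)

/-- The Mecke formula for a marked unit rate Poisson process and the indicator of a set. -/
lemma tsum_markedLaw_remove {E : Type*} [MeasurableSpace E] (ν : Measure E)
    [IsProbabilityMeasure ν] {S : Set (ℝ × E × (ℕ → ℝ) × (ℕ → E))} (hS : MeasurableSet S) :
    ∑' j, ∫⁻ p, S.indicator (fun _ => (1 : ℝ≥0∞)) (arrivals p.1 j, p.2 j,
        fun i => arrivals p.1 (skip j i), fun i => p.2 (skip j i)) ∂markedLaw ν =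
      ∫⁻ p, ∫⁻ v, (∫⁻ u in Set.Ioi 0, S.indicator (fun _ => (1 : ℝ≥0∞)) (u, v, arrivals p.1, p.2)) ∂ν
        ∂markedLaw ν := by
  have hF : Measurable (S.indicator (fun _ => (1 : ℝ≥0∞))) := measurable_const.indicator hS
  have h1 := tsum_lintegral_remove ν 
    (F := fun u v g w => S.indicator (fun _ => (1 : ℝ≥0∞)) (u, v, g, w)) hF
  have hL (j : ℕ) : Measurable fun p : (ℕ → ℝ) × (ℕ → E) => S.indicator (fun _ => (1 : ℝ≥0∞))
      (arrivals p.1 j, p.2 j, (fun i => arrivals p.1 (skip j i)), fun i => p.2 (skip j i)) :=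
    hF.comp (by fun_prop)
  have hI : Measurable fun q : (((ℕ → ℝ) × (ℕ → E)) × E) × ℝ =>
      S.indicator (fun _ => (1 : ℝ≥0∞)) (q.2, q.1.2, arrivals q.1.1.1, q.1.1.2) :=
    hF.comp (by fun_prop)
  have hJ : Measurable fun p : (ℕ → ℝ) × (ℕ → E) =>
      ∫⁻ v, (∫⁻ u in Set.Ioi 0, S.indicator (fun _ => (1 : ℝ≥0∞)) (u, v, arrivals p.1, p.2)) ∂ν :=
    hI.lintegral_prod_right'.lintegral_prod_right'
  simp_rw [lintegral_prod _ (hL _).aemeasurable]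
  rw [h1, lintegral_prod _ hJ.aemeasurable]
  refine lintegral_congr fun x => ?_
  have hK : Measurable fun q : (ℝ × (ℕ → E)) × E =>
      S.indicator (fun _ => (1 : ℝ≥0∞)) (q.1.1, q.2, arrivals x, q.1.2) := hF.comp (by fun_prop)
  rw [lintegral_lintegral_swap]
  · refine lintegral_congr fun w => ?_
    rw [lintegral_lintegral_swap]
    have : Measurable fun q : ℝ × E => S.indicator (fun _ => (1 : ℝ≥0∞)) (q.1, q.2, arrivals x, w) :=
      hF.comp (by fun_prop)
    exact this.aemeasurable
  · exact hK.lintegral_prod_right'.aemeasurable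

section Regular
variable {N : ℕ} (ν : Measure (Fin N → ℝ)) [IsProbabilityMeasure ν]

/-- Almost surely, no two of the scaled functions share a positive value at some point. -/
lemma ae_markedLaw_no_tie :
    ∀ᵐ p ∂markedLaw ν, ∀ i j k, scaled (arrivals p.1) p.2 i k = scaled (arrivals p.1) p.2 j k →
      0 < scaled (arrivals p.1) p.2 j k → i = j := by
  let S : Set (ℝ × (Fin N → ℝ) × (ℕ → ℝ) × (ℕ → Fin N → ℝ)) :=
    ⋃ k : Fin N, ⋃ i : ℕ, {q | (q.2.2.1 i)⁻¹ * q.2.2.2 i k = q.1⁻¹ * q.2.1 k} ∩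
      {q | 0 < q.1⁻¹ * q.2.1 k}
  have hS : MeasurableSet S := by
    refine MeasurableSet.iUnion fun k => MeasurableSet.iUnion fun i => ?_
    exact (measurableSet_eq_fun (by fun_prop) (by fun_prop)).inter
      (measurableSet_lt (by fun_prop) (by fun_prop))
  have hzero : ∫⁻ p, ∫⁻ v, (∫⁻ u in Set.Ioi 0,
      S.indicator (fun _ => (1 : ℝ≥0∞)) (u, v, arrivals p.1, p.2)) ∂ν ∂markedLaw ν = 0 := by
    have (p : (ℕ → ℝ) × (ℕ → Fin N → ℝ)) (v : Fin N → ℝ) : ∫⁻ u in Set.Ioi (0 : ℝ),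
        S.indicator (fun _ => (1 : ℝ≥0∞)) (u, v, arrivals p.1, p.2) = 0 := by
      -- A tie at a positive value determines `u` from `v`, the point and the index of the other
      -- function, leaving countably many levels.
      have hc : {u : ℝ | (u, v, arrivals p.1, p.2) ∈ S}.Countable := by
        refine Set.Countable.mono (s₂ := ⋃ k : Fin N, ⋃ i : ℕ,
          {v k / ((arrivals p.1 i)⁻¹ * p.2 i k)}) ?_
          (Set.countable_iUnion fun k => Set.countable_iUnion fun i => Set.countable_singleton _)
        intro u hu
        simp only [S, Set.mem_ofPred_eq, Set.mem_iUnion, Set.mem_inter_iff] at hu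
        obtain ⟨k, i, h1, h2⟩ := hu
        simp only [Set.mem_iUnion, Set.mem_singleton_iff]
        refine ⟨k, i, ?_⟩
        rw [h1]
        have h3 : u⁻¹ ≠ 0 := left_ne_zero_of_mul h2.ne'
        have h4 : v k ≠ 0 := right_ne_zero_of_mul h2.ne'
        have h5 : u ≠ 0 := inv_eq_zero.not.1 h3
        field_simp
      have h0 : ∀ᵐ u : ℝ, (u, v, arrivals p.1, p.2) ∉ S := by
        rw [ae_iff]
        simpa using hc.measure_zero volume
      rw [lintegral_congr_ae (g := 0)]
      · simp
      · filter_upwards [ae_restrict_of_ae h0] with u hu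
        simp [hu]
    simp [this]
  rw [← tsum_markedLaw_remove ν hS, ENNReal.tsum_eq_zero] at hzero
  have hall : ∀ᵐ p ∂markedLaw ν, ∀ j, (arrivals p.1 j, p.2 j,
      (fun i => arrivals p.1 (skip j i)), fun i => p.2 (skip j i)) ∉ S := by
    refine ae_all_iff.2 fun j => ?_
    have hF : Measurable (S.indicator (fun _ => (1 : ℝ≥0∞))) := measurable_const.indicator hS
    have := (lintegral_eq_zero_iff (hF.comp (by fun_prop : Measurable fun p : (ℕ → ℝ) ×
      (ℕ → Fin N → ℝ) => (arrivals p.1 j, p.2 j, (fun i => arrivals p.1 (skip j i)),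
        fun i => p.2 (skip j i))))).1 (hzero j)
    filter_upwards [this] with p hp hmem
    simp [Set.indicator_of_mem hmem] at hp
  filter_upwards [hall] with p hp i j k hij hpos
  by_contra hne
  obtain ⟨l, rfl⟩ := exists_skip_eq hne
  refine hp j ?_
  simp only [S, Set.mem_iUnion]
  exact ⟨k, l, hij, hpos⟩

variable {ν}

lemma ae_markedLaw_isRegular (h0 : ∀ᵐ v ∂ν, ∀ k, 0 ≤ v k) (h1 : ∀ k, ∫ v, v k ∂ν = 1) :
    ∀ᵐ p ∂markedLaw ν, IsRegular (scaled (arrivals p.1) p.2) := by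
  have hx : ∀ᵐ x ∂expSeq, (∀ i, 0 < x i) ∧
      ∃ c : ℝ, 0 < c ∧ ∀ᶠ n : ℕ in atTop, c * n ≤ ∑ i ∈ Finset.range n, x i :=
    ae_expSeq_pos.and ae_expSeq_linear_growth
  have hw0 : ∀ᵐ w ∂(Measure.infinitePi fun _ : ℕ => ν), ∀ i : ℕ, ∀ k, 0 ≤ w i k :=
    ae_all_iff.2 fun i =>
      (measurePreserving_eval_infinitePi (fun _ : ℕ => ν) i).quasiMeasurePreserving.ae h0
  have hw1 : ∀ᵐ w : ℕ → Fin N → ℝ ∂(Measure.infinitePi fun _ : ℕ => ν), ∀ k : Fin N,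
      Tendsto (fun n : ℕ => (∑ i ∈ Finset.range n, w i k) / (n : ℝ)) atTop (𝓝 (1 : ℝ)) := by
    refine ae_all_iff.2 fun k => ?_
    have := ae_tendsto_average ν (f := fun v => v k) (measurable_pi_apply k)
      -- A non-integrable function would have Bochner integral `0`, so mean `1` already gives
      -- integrability.
      (Integrable.of_integral_ne_zero (by rw [h1 k]; exact one_ne_zero))
    rwa [h1 k] at this
  have hx' := Measure.quasiMeasurePreserving_fst (μ := expSeq)
    (ν := Measure.infinitePi fun _ : ℕ => ν) |>.ae hx
  have hw' := Measure.quasiMeasurePreserving_snd (μ := expSeq)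
    (ν := Measure.infinitePi fun _ : ℕ => ν) |>.ae (hw0.and hw1)
  filter_upwards [hx', hw', ae_markedLaw_no_tie ν] with p ⟨hp, c, hc, hg⟩ ⟨hw0, hw1⟩ htie
  have harr (j : ℕ) : 0 < arrivals p.1 j :=
    Finset.sum_pos (fun i _ => hp i) ⟨0, by simp⟩
  refine ⟨fun j k => mul_nonneg (inv_nonneg.2 (harr j).le) (hw0 j k), fun k =>
    tendsto_scaled hc hg (fun i => hw0 i k) (tendsto_div_of_tendsto_average (hw1 k)),
    fun k => ?_, htie⟩
  by_contra! hcon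
  have hz (i : ℕ) : p.2 i k = 0 := by
    refine le_antisymm ?_ (hw0 i k)
    exact nonpos_of_mul_nonpos_right (hcon i) (inv_pos.2 (harr i))
  have := hw1 k
  simp only [hz, Finset.sum_const_zero, zero_div] at this
  exact zero_ne_one (tendsto_nhds_unique tendsto_const_nhds this)

lemma measurableSet_mem_recordSet {ι : Type*} [Countable ι] (e : ι → Fin N) (j : ℕ) :
    MeasurableSet {p : (ℕ → ℝ) × (ℕ → Fin N → ℝ) |
      j ∈ recordSet e (scaled (arrivals p.1) p.2)} := by
  have : {p : (ℕ → ℝ) × (ℕ → Fin N → ℝ) | j ∈ recordSet e (scaled (arrivals p.1) p.2)} =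
      ⋃ i, ⋂ l, {p | (arrivals p.1 l)⁻¹ * p.2 l (e i) ≤ (arrivals p.1 j)⁻¹ * p.2 j (e i)} := by
    ext p; simp [recordSet, scaled]
  rw [this]
  exact MeasurableSet.iUnion fun i => MeasurableSet.iInter fun l =>
    measurableSet_le (by fun_prop) (by fun_prop)

lemma measurable_encard {α : Type*} [MeasurableSpace α] {s : α → Set ℕ}
    (hs : ∀ j, MeasurableSet {a | j ∈ s a}) : Measurable fun a => ((s a).encard : ℝ≥0∞) := by
  simp_rw [encard_eq_tsum]
  refine Measurable.tsum fun j => ?_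
  exact (measurable_one.indicator (hs j) : Measurable ({a | j ∈ s a}.indicator (1 : α → ℝ≥0∞)))

lemma measurable_encard_recordSet {ι : Type*} [Countable ι] (e : ι → Fin N) :
    Measurable fun p : (ℕ → ℝ) × (ℕ → Fin N → ℝ) =>
      ((recordSet e (scaled (arrivals p.1) p.2)).encard : ℝ≥0∞) :=
  measurable_encard (measurableSet_mem_recordSet e)

/-- The expected number of functions attaining the maximum at one of the points `e i`. -/
lemma lintegral_encard_recordSet (h0 : ∀ᵐ v ∂ν, ∀ k, 0 ≤ v k) (h1 : ∀ k, ∫ v, v k ∂ν = 1)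
    {ι : Type*} [Finite ι] (e : ι → Fin N) :
    ∫⁻ p, (recordSet e (scaled (arrivals p.1) p.2)).encard ∂markedLaw ν =
      ∫⁻ p, ∫⁻ v, ENNReal.ofReal (⨆ i, v (e i) / ⨆ j, scaled (arrivals p.1) p.2 j (e i)) ∂ν
        ∂markedLaw ν := by
  let S : Set (ℝ × (Fin N → ℝ) × (ℕ → ℝ) × (ℕ → Fin N → ℝ)) :=
    {q | ∃ i, ∀ l, scaled q.2.2.1 q.2.2.2 l (e i) ≤ q.1⁻¹ * q.2.1 (e i)}
  have hS : MeasurableSet S := by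
    have : S = ⋃ i, ⋂ l, {q | (q.2.2.1 l)⁻¹ * q.2.2.2 l (e i) ≤ q.1⁻¹ * q.2.1 (e i)} := by
      ext; simp [S, scaled]
    rw [this]
    exact MeasurableSet.iUnion fun i => MeasurableSet.iInter fun l =>
      measurableSet_le (by fun_prop) (by fun_prop)
  have hmem (p : (ℕ → ℝ) × (ℕ → Fin N → ℝ)) (j : ℕ) :
      (arrivals p.1 j, p.2 j, (fun i => arrivals p.1 (skip j i)), fun i => p.2 (skip j i)) ∈ S ↔
        j ∈ recordSet e (scaled (arrivals p.1) p.2) := by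
    -- Comparing `φ_j` with itself is vacuous, so being a record against the other functions is
    -- being a record.
    refine exists_congr fun i => ⟨fun h l => ?_, fun h l => h (skip j l)⟩
    by_cases hl : l = j
    · rw [hl]
    · obtain ⟨m, rfl⟩ := exists_skip_eq hl
      exact h m
  simp_rw [encard_eq_tsum]
  rw [lintegral_tsum]
  · have hind (p : (ℕ → ℝ) × (ℕ → Fin N → ℝ)) (j : ℕ) :
        (recordSet e (scaled (arrivals p.1) p.2)).indicator (1 : ℕ → ℝ≥0∞) j =
          S.indicator (fun _ => (1 : ℝ≥0∞)) (arrivals p.1 j, p.2 j,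
            (fun i => arrivals p.1 (skip j i)), fun i => p.2 (skip j i)) := by
      by_cases hj : j ∈ recordSet e (scaled (arrivals p.1) p.2)
      · rw [Set.indicator_of_mem hj, Set.indicator_of_mem ((hmem p j).2 hj), Pi.one_apply]
      · rw [Set.indicator_of_notMem hj, Set.indicator_of_notMem (mt (hmem p j).1 hj)]
    simp_rw [hind]
    rw [tsum_markedLaw_remove ν hS]
    refine lintegral_congr_ae ?_
    filter_upwards [ae_markedLaw_isRegular h0 h1] with p hp
    refine lintegral_congr fun v => ?_
    rw [← hp.lintegral_record e v]
    simp only [Set.indicator, Pi.one_apply]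
    rfl
  · intro j
    exact (measurable_one.indicator (measurableSet_mem_recordSet e j)).aemeasurable

end Regular

/-! ### Transfer from the canonical model to the given processes -/

section Transfer

lemma arrivals_interarrival {Ω : Type*} (Γ : ℕ → Ω → ℝ) (ω : Ω) :
    arrivals (fun j => interarrival Γ j ω) = fun j => Γ j ω := by
  funext j
  unfold arrivals
  induction j with
  | zero => simp [interarrival]
  | succ j ih => rw [Finset.sum_range_succ, ih]; simp [interarrival]

lemma measurable_interarrival :
    Measurable fun (g : ℕ → ℝ) (j : ℕ) => interarrival (fun j (g : ℕ → ℝ) => g j) j g := by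
  refine measurable_pi_lambda _ fun j => ?_
  cases j <;> simp only [interarrival] <;> fun_prop

lemma phi_eq_scaled {Ω : Type*} {N : ℕ} (Γ : ℕ → Ω → ℝ) (W : ℕ → Ω → Fin N → ℝ) (ω : Ω) :
    phi Γ W ω = scaled (arrivals fun j => interarrival Γ j ω) (fun j => W j ω) := by
  rw [arrivals_interarrival]; rfl

variable {Ω Ω' : Type*} [MeasurableSpace Ω] [MeasurableSpace Ω'] {N : ℕ}
  {V : Ω → Fin N → ℝ} {P : Measure Ω} {Γ : ℕ → Ω' → ℝ} {W : ℕ → Ω' → Fin N → ℝ} {P' : Measure Ω'}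

lemma IsMarkedPoisson.hasLaw [IsProbabilityMeasure P'] [IsProbabilityMeasure (P.map V)]
    (h : IsMarkedPoisson V P Γ W P') :
    HasLaw (fun ω => (fun j => interarrival Γ j ω, fun j => W j ω)) (markedLaw (P.map V)) P' := by
  have hX : AEMeasurable (fun ω j => interarrival Γ j ω) P' :=
    aemeasurable_pi_iff.2 fun j => (h.arrival.law j).aemeasurable
  have hW : AEMeasurable (fun ω j => W j ω) P' :=
    aemeasurable_pi_iff.2 fun j => (h.mark_law j).aemeasurable_fst
  refine ⟨hX.prodMk hW, ?_⟩
  have hind : IndepFun (fun ω j => interarrival Γ j ω) (fun ω j => W j ω) P' := by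
    -- Interarrival times are a measurable function of the arrivals, so they inherit independence
    -- from the marks.
    have := h.indep.comp measurable_interarrival measurable_id
    convert this using 1
    · funext ω j
      cases j <;> rfl
    · rfl
  rw [(indepFun_iff_map_prod_eq_prod_map_map hX hW).1 hind]
  congr 1
  · rw [h.arrival.indep.map_fun_eq_infinitePi_map₀ hX]
    congr 1 with j : 1
    exact (h.arrival.law j).map_eq
  · rw [h.mark_indep.map_fun_eq_infinitePi_map₀ hW]
    congr 1 with j : 1
    exact (h.mark_law j).map_eq

end Transfer

/-! ### Expectations and the final subtraction -/

section Expectation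
variable {Ω Ω' : Type*} [MeasurableSpace Ω] [MeasurableSpace Ω'] {N : ℕ}
  {V Z : Ω → Fin N → ℝ} {P : Measure Ω}
  {Γ : ℕ → Ω' → ℝ} {W : ℕ → Ω' → Fin N → ℝ} {P' : Measure Ω'}

lemma measurable_maxProcess_scaled : Measurable fun (p : (ℕ → ℝ) × (ℕ → Fin N → ℝ)) k =>
    ⨆ j, scaled (arrivals p.1) p.2 j k := by
  refine measurable_pi_lambda _ fun k => Measurable.iSup fun j => ?_
  unfold scaled
  fun_prop

lemma measurable_iSup_div {ι : Type*} [Countable ι] (e : ι → Fin N) :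
    Measurable fun q : (Fin N → ℝ) × (Fin N → ℝ) => ⨆ i, q.2 (e i) / q.1 (e i) :=
  Measurable.iSup fun i => by fun_prop

lemma IsSpectralProcess.ae_map_nonneg (hV : IsSpectralProcess V P) :
    ∀ᵐ v ∂P.map V, ∀ k, 0 ≤ v k := by
  rw [ae_map_iff hV.aemeasurable]
  · exact hV.nonneg
  · exact measurableSet_Ici (a := (0 : Fin N → ℝ))

lemma IsSpectralProcess.integral_map (hV : IsSpectralProcess V P) (k : Fin N) :
    ∫ v, v k ∂P.map V = 1 := by
  rw [MeasureTheory.integral_map hV.aemeasurable (measurable_pi_apply k).aestronglyMeasurable,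
    hV.mean_one]

variable [IsProbabilityMeasure P] [IsProbabilityMeasure P']

lemma IsMarkedPoisson.ae_isRegular (hV : IsSpectralProcess V P) (h : IsMarkedPoisson V P Γ W P') :
    ∀ᵐ ω ∂P', IsRegular (phi Γ W ω) := by
  have := Measure.isProbabilityMeasure_map hV.aemeasurable
  have hreg := ae_markedLaw_isRegular hV.ae_map_nonneg hV.integral_map
  rw [← h.hasLaw.map_eq] at hreg
  filter_upwards [ae_of_ae_map h.hasLaw.aemeasurable hreg] with ω hω
  rw [phi_eq_scaled]
  exact hω

lemma IsMarkedPoisson.aemeasurable_encard (hV : IsSpectralProcess V P)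
    (h : IsMarkedPoisson V P Γ W P') {ι : Type*} [Countable ι] (e : ι → Fin N) :
    AEMeasurable (fun ω => ((recordSet e (phi Γ W ω)).encard : ℝ≥0∞)) P' := by
  have := Measure.isProbabilityMeasure_map hV.aemeasurable
  have hc := (measurable_encard_recordSet e).comp_aemeasurable h.hasLaw.aemeasurable
  refine hc.congr (ae_of_all _ fun ω => ?_)
  simp only [phi_eq_scaled, Function.comp_apply]

/-- The expected number of extremal functions at the points `e i` is the expectation of
`max V / Z` over these points. -/
lemma IsMarkedPoisson.lintegral_encard (hV : IsSpectralProcess V P)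
    (h : IsMarkedPoisson V P Γ W P') (hZ : IdentDistrib Z (maxProcess Γ W) P P')
    (hZV : IndepFun Z V P) {ι : Type*} [Finite ι] (e : ι → Fin N) :
    ∫⁻ ω, (recordSet e (phi Γ W ω)).encard ∂P' =
      ∫⁻ ω, ENNReal.ofReal (⨆ i, V ω (e i) / Z ω (e i)) ∂P := by
  have := Measure.isProbabilityMeasure_map hV.aemeasurable
  have hmap : P.map Z = (markedLaw (P.map V)).map
      (fun p k => ⨆ j, scaled (arrivals p.1) p.2 j k) := by
    rw [hZ.map_eq, ← h.hasLaw.map_eq,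
      AEMeasurable.map_map_of_aemeasurable measurable_maxProcess_scaled.aemeasurable
        h.hasLaw.aemeasurable]
    congr 1
    funext ω k
    simp only [maxProcess, phi_eq_scaled, Function.comp]
  have hf : Measurable fun q : (Fin N → ℝ) × (Fin N → ℝ) =>
      ENNReal.ofReal (⨆ i, q.2 (e i) / q.1 (e i)) :=
    (measurable_iSup_div e).ennreal_ofReal
  have hR : ∫⁻ ω, ENNReal.ofReal (⨆ i, V ω (e i) / Z ω (e i)) ∂P =
      ∫⁻ z, ∫⁻ v, ENNReal.ofReal (⨆ i, v (e i) / z (e i)) ∂P.map V ∂P.map Z := by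
    rw [← lintegral_prod _ hf.aemeasurable,
      ← (indepFun_iff_map_prod_eq_prod_map_map hZ.aemeasurable_fst hV.aemeasurable).1 hZV,
      lintegral_map' hf.aemeasurable (hZ.aemeasurable_fst.prodMk hV.aemeasurable)]
  rw [hR, hmap, lintegral_map hf.lintegral_prod_right' measurable_maxProcess_scaled,
    ← lintegral_encard_recordSet hV.ae_map_nonneg hV.integral_map e, ← h.hasLaw.map_eq,
    lintegral_map' (measurable_encard_recordSet e).aemeasurable
      h.hasLaw.aemeasurable]
  simp_rw [phi_eq_scaled]

lemma IsMarkedPoisson.lintegral_encard_ne_top (hV : IsSpectralProcess V P)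
    (h : IsMarkedPoisson V P Γ W P') {ι : Type*} [Fintype ι] (e : ι → Fin N) :
    ∫⁻ ω, (recordSet e (phi Γ W ω)).encard ∂P' ≠ ⊤ := by
  refine ne_top_of_le_ne_top (b := ((Fintype.card ι : ℕ) : ℝ≥0∞)) (ENNReal.natCast_ne_top _) ?_
  calc ∫⁻ ω, (recordSet e (phi Γ W ω)).encard ∂P'
      ≤ ∫⁻ _, ((Fintype.card ι : ℕ) : ℝ≥0∞) ∂P' := by
        refine lintegral_mono_ae ?_
        filter_upwards [h.ae_isRegular hV] with ω hω
        have := ENat.toENNReal_mono (hω.encard_recordSet_le e)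
        simpa using this
    _ = _ := by simp

lemma ae_iSup_div_nonneg (hV : IsSpectralProcess V P) (h : IsMarkedPoisson V P Γ W P')
    (hZ : IdentDistrib Z (maxProcess Γ W) P P') {ι : Type*} (e : ι → Fin N) :
    ∀ᵐ ω ∂P, 0 ≤ ⨆ i, V ω (e i) / Z ω (e i) := by
  have hs : MeasurableSet {z : Fin N → ℝ | ∀ k, 0 ≤ z k} :=
    measurableSet_Ici (a := (0 : Fin N → ℝ))
  have hZ0 : ∀ᵐ ω ∂P, Z ω ∈ {z : Fin N → ℝ | ∀ k, 0 ≤ z k} := by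
    refine hZ.symm.ae_mem_snd hs ?_
    filter_upwards [h.ae_isRegular hV] with ω hω k
    exact (hω.iSup_pos k).le
  filter_upwards [hV.nonneg, hZ0] with ω h1 h2
  exact Real.iSup_nonneg fun i => div_nonneg (h1 _) (h2 _)

lemma integrable_iSup_div (hV : IsSpectralProcess V P) (h : IsMarkedPoisson V P Γ W P')
    (hZ : IdentDistrib Z (maxProcess Γ W) P P') (hZV : IndepFun Z V P)
    {ι : Type*} [Fintype ι] (e : ι → Fin N) :
    Integrable (fun ω => ⨆ i, V ω (e i) / Z ω (e i)) P := by
  have hm : AEMeasurable (fun ω => ⨆ i, V ω (e i) / Z ω (e i)) P :=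
    (measurable_iSup_div e).comp_aemeasurable (hZ.aemeasurable_fst.prodMk hV.aemeasurable)
  rw [← lintegral_ofReal_ne_top_iff_integrable hm.aestronglyMeasurable
    (ae_iSup_div_nonneg hV h hZ e), ← h.lintegral_encard hV hZ hZV e]
  exact h.lintegral_encard_ne_top hV e

end Expectation

end MaxStable


theorem mainTheorem4
    {Ω Ω' : Type*} [MeasurableSpace Ω] [MeasurableSpace Ω']
    (P : Measure Ω) [IsProbabilityMeasure P] (P' : Measure Ω') [IsProbabilityMeasure P']
    {N n : ℕ} (hn : n ≤ N)
    (V Z : Ω → Fin N → ℝ) (Γ : ℕ → Ω' → ℝ) (W : ℕ → Ω' → Fin N → ℝ)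
    (hV : MaxStable.IsSpectralProcess V P)
    (hΓW : MaxStable.IsMarkedPoisson V P Γ W P')
    (hZ : IdentDistrib Z (MaxStable.maxProcess Γ W) P P')
    (hZV : IndepFun Z V P) :
    AEMeasurable (fun ω => (MaxStable.missing Γ W n ω : ENNReal)) P' ∧
    Integrable (fun ω => ⨆ k : Fin N, V ω k / Z ω k) P ∧
    Integrable (fun ω => ⨆ i : Fin n, V ω (Fin.castLE hn i) / Z ω (Fin.castLE hn i)) P ∧
    ∫⁻ ω, (MaxStable.missing Γ W n ω : ENNReal) ∂P' ≠ ⊤ ∧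
    (∫⁻ ω, (MaxStable.missing Γ W n ω : ENNReal) ∂P').toReal =
      ∫ ω, (⨆ k : Fin N, V ω k / Z ω k) ∂P -
      ∫ ω, (⨆ i : Fin n, V ω (Fin.castLE hn i) / Z ω (Fin.castLE hn i)) ∂P := by
  have hreg := hΓW.ae_isRegular hV
  have hid := hΓW.aemeasurable_encard hV (id : Fin N → Fin N)
  have hle := hΓW.aemeasurable_encard hV (Fin.castLE hn)
  have hle_top := hΓW.lintegral_encard_ne_top hV (Fin.castLE hn)
  have hid_top := hΓW.lintegral_encard_ne_top hV (id : Fin N → Fin N)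
  -- The identity is kept additive until finiteness permits subtraction.
  have hadd : ∀ᵐ ω ∂P', (MaxStable.missing Γ W n ω : ENNReal) +
      (MaxStable.recordSet (Fin.castLE hn) (MaxStable.phi Γ W ω)).encard =
      (MaxStable.recordSet id (MaxStable.phi Γ W ω)).encard := by
    filter_upwards [hreg] with ω hω
    rw [MaxStable.missing, MaxStable.encard_missing hω hn, ← ENat.toENNReal_add,
      Set.encard_sdiff_add_encard_of_subset (MaxStable.recordSet_subset _ _)]
  have hfin : ∀ᵐ ω ∂P',
      ((MaxStable.recordSet (Fin.castLE hn) (MaxStable.phi Γ W ω)).encard : ENNReal) ≠ ⊤ :=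
    (ae_lt_top' hle hle_top).mono fun _ h => h.ne
  have hmeas : AEMeasurable (fun ω => (MaxStable.missing Γ W n ω : ENNReal)) P' := by
    -- Off a null set the found count is finite, so truncated subtraction recovers the missing
    -- count.
    refine (hid.sub hle).congr ?_
    filter_upwards [hadd, hfin] with ω h1 h2
    simp only [Pi.sub_apply]
    rw [← h1, ENNReal.add_sub_cancel_right h2]
  have hsum : ∫⁻ ω, (MaxStable.missing Γ W n ω : ENNReal) ∂P' +
      ∫⁻ ω, (MaxStable.recordSet (Fin.castLE hn) (MaxStable.phi Γ W ω)).encard ∂P' =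
      ∫⁻ ω, (MaxStable.recordSet id (MaxStable.phi Γ W ω)).encard ∂P' := by
    rw [← lintegral_add_left' hmeas]
    exact lintegral_congr_ae hadd
  have hmtop : ∫⁻ ω, (MaxStable.missing Γ W n ω : ENNReal) ∂P' ≠ ⊤ :=
    ne_top_of_le_ne_top hid_top (hsum ▸ le_self_add)
  have hint_id := MaxStable.integrable_iSup_div hV hΓW hZ hZV (id : Fin N → Fin N)
  have hint_le := MaxStable.integrable_iSup_div hV hΓW hZ hZV (Fin.castLE hn)
  refine ⟨hmeas, hint_id, hint_le, hmtop, ?_⟩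
  have e1 := integral_eq_lintegral_of_nonneg_ae
    (MaxStable.ae_iSup_div_nonneg hV hΓW hZ (id : Fin N → Fin N)) hint_id.aestronglyMeasurable
  have e2 := integral_eq_lintegral_of_nonneg_ae
    (MaxStable.ae_iSup_div_nonneg hV hΓW hZ (Fin.castLE hn)) hint_le.aestronglyMeasurable
  rw [← hΓW.lintegral_encard hV hZ hZV] at e1 e2
  simp only [id] at e1
  rw [e1, e2, eq_sub_iff_add_eq, ← ENNReal.toReal_add hmtop hle_top, hsum]
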